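/- **Setting.** Let $\mathcal S,\mathcal X,\mathcal Y,\widehat{\mathcal S}$ be finite alphabets ($\mathcal X,\widehat{\mathcal S}$ non-empty), $P_S$ a probability distribution on $\mathcal S$, $P_{Y|X}$ a channel, $d:\mathcal S\times\widehat{\mathcal S}\to[0,\infty]$ a distortion function, $\mathbf d\in[0,\infty)$, and $\kappa(s,x,y,\widehat s)=\mathbb I\{d(s,\widehat s)>\mathbf d\}$. A randomized code is a pair of conditional distributions $(Q_{X|S},Q_{\widehat S|Y})$; a deterministic code is a pair of maps $f:\mathcal S\to\mathcal X$, $g:\mathcal Y\to\widehat{\mathcal S}$. Let $\mathrm{OPT(SC)}$ be the infimum of $$\sum_{s,x,y,\widehat s}\kappa(s,x,y,\widehat s)P_S(s)Q_{X|S}(x|s)P_{Y|X}(y|x)Q_{\widehat S|Y}(\widehat s|y)$$ over all randomized codes, and let $\mathrm{OPT(DP)}$ be the supremum of $\sum_s\gamma^a(s)+\sum_y\gamma^b(y)-\sum_{s,x,y,\widehat s}\mu(s,x,y,\widehat s)$ over real-valued functions $\gamma^a,\gamma^b,\lambda^a,\lambda^b,\mu$ with $\mu\ge0$ and, for all $s,x,y,\widehat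 s$, $$\text{(D1)}\ \ \gamma^a(s)\le\sum_y\lambda^b(x,s,y)+\sum_{\widehat s,y}\mu(s,x,y,\widehat s),\qquad \text{(D2)}\ \ \gamma^b(y)\le\sum_s\lambda^a(s,\widehat s,y)+\sum_{x,s}\mu(s,x,y,\widehat s),$$ $$\text{(D3)}\ \ \lambda^a(s,\widehat s,y)+\lambda^b(x,s,y)+\mu(s,x,y,\widehat s)\le\kappa(s,x,y,\widehat s)P_S(s)P_{Y|X}(y|x).$$ **Tilted information.** Let $R_S(\delta)=\inf\{I(S;\widehat S):P_{\widehat S|S},\ \mathbb E[d(S,\widehat S)]\le\delta\}$ (natural logarithms, $\inf\emptyset=\infty$) and $\mathbf d_{\min}=\inf\{\delta:R_S(\delta)<\infty\}$. If $\mathbf d=0$, put $j_S(s,0)=\log\frac1{P_S(s)}$. If $\mathbf d>0$, assume that $\mathbf d>\mathbf d_{\min}$, that the infimum defining $R_S(\mathbf d)$ is attained by a $P_{\widehat S^*|S}$ which is unique (at the $s$ with $P_S(s)>0$), and that $R_S$ is differentiable at $\mathbf d$ with $\lambda^*=-R_S'(\mathbf d)>0$; put $$j_S(s,\mathbf d)=\log\frac1{\mathbb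 E[\exp(\lambda^*\mathbf d-\lambda^*d(s,\widehat S^*))]},$$ the expectation being over the marginal $P_{\widehat S^*}$, with $\exp(-\infty)=0$. **Auxiliary variables.** For a positive integer $T$ let $V$ be a random variable on $\{1,\dots,T\}$ given by conditional distributions $P_{V|X}$, $P_{Y|X,V}$ with $P_{Y|X}(y|x)=\sum_{t=1}^TP_{Y|X,V}(y|x,t)P_{V|X}(t|x)$, and let $P_{\bar Y|V=t}$ be distributions on $\mathcal Y$ such that $P_{\bar Y|V}(y|t)=0$ implies $P_{Y|X,V}(y|x,t)=0$ for all $x$. Put $i_{X;\bar Y|V}(x;y|t)=\log\frac{P_{Y|X,V}(y|x,t)}{P_{\bar Y|V}(y|t)}$ (with $\log 0=-\infty$). For $\gamma\in\mathbb R$ let $$M=\mathbb E\Bigl[\inf_x\Bigl\{\mathbb P[j_S(S,\mathbf d)-i_{X;\bar Y|V}(x;Y|V)\ge\gamma\mid S]+\exp(j_S(S,\mathbf d)-\gamma)\sum_{y}\sum_{t=1}^TP_{V|X}(t|x)P_{\bar Y|V}(y|t)\,\mathbb I\{i_{X;\bar Y|V}(x;y|t)>j_S(S,\mathbf d)-\gamma\}\Bigr\}\Bigr],$$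 where $\mathbb P$ is generated by $P_{V|X=x}P_{Y|X=x,V}$ and $\mathbb E$ is with respect to $P_S$, and $$B_{\rm old}=M-Te^{-\gamma},\qquad B_{\rm new}=M-T\sup_{\widehat s}\mathbb E\bigl[\exp(j_S(S,\mathbf d)-\gamma)\,\mathbb I\{d(S,\widehat s)\le\mathbf d\}\bigr].$$ **Theorem (Joint Source-Channel Coding – Further Improvement).** 1. For every code, deterministic or randomized, $$\mathbb E[\mathbb I\{d(S,\widehat S)>\mathbf d\}]\ \ge\ \mathrm{OPT(SC)}\ \ge\ \mathrm{OPT(DP)}\ \ge\ \sup_{\gamma\in\mathbb R,\,T\ge1}\ \sup_{\bar Y,V}B_{\rm new}.$$ 2. For all $\gamma,T,\bar Y,V$, the value $B_{\rm new}$ is the objective value of the following feasible point of DP: $$\lambda^b(x,s,y)=P_S(s)\sum_{t=1}^T\Bigl[P_{Y|X,V}(y|x,t)P_{V|X}(t|x)\mathbb I\{P_{Y|X,V}(y|x,t)\le P_{\bar Y|V}(y|t)e^{j_S(s,\mathbf d)-\gamma}\}+P_{\bar Y|V}(y|t)e^{j_S(s,\mathbf d)-\gamma}P_{V|X}(t|x)\mathbb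 I\{P_{Y|X,V}(y|x,t)>P_{\bar Y|V}(y|t)e^{j_S(s,\mathbf d)-\gamma}\}\Bigr],$$ $$\lambda^a(s,\widehat s,y)=-P_S(s)e^{j_S(s,\mathbf d)-\gamma}\mathbb I\{d(s,\widehat s)\le\mathbf d\}\sum_{t=1}^TP_{\bar Y|V}(y|t),$$ $\gamma^a(s)=\inf_x\sum_y\lambda^b(x,s,y)$, $\gamma^b(y)=\min_{\widehat s}\sum_s\lambda^a(s,\widehat s,y)$, $\mu\equiv0$; and this $\gamma^b$ is optimal: any $\gamma^b$ that keeps the point feasible, the other variables being unchanged, is pointwise at most this one. 3. The bound improves on the earlier one. Suppose, if $\mathbf d=0$, that for each $\widehat s$ at most one $s$ with $P_S(s)>0$ has $d(s,\widehat s)=0$ (no condition if $\mathbf d>0$). Then $B_{\rm old}\le B_{\rm new}$ for all $\gamma,T,\bar Y,V$, and hence $\sup_{\gamma,T}\sup_{\bar Y,V}B_{\rm old}\le\sup_{\gamma,T}\sup_{\bar Y,V}B_{\rm new}$. -/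

import Mathlib

open scoped ENNReal NNReal

namespace JSCC

section

variable {S X Y Sh A B : Type*}

/-- The indicator (0 or 1) of a proposition. -/
noncomputable def ind (p : Prop) : ℝ :=
  open Classical in if p then 1 else 0

/-- `K a b` is a conditional probability `K(b|a)` on a finite alphabet. -/
def IsKernel [Fintype B] (K : A → B → ℝ) : Prop :=
  ∀ a, K a ∈ stdSimplex ℝ B

/-! ### The source-channel coding problem and the dual program -/

/-- Expected loss of the randomized code with encoder `Q` and decoder `R`. -/
noncomputable def expectedLoss [Fintype S] [Fintype X] [Fintype Y] [Fintype Sh]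
    (P : S → ℝ) (W : X → Y → ℝ) (κ : S → X → Y → Sh → ℝ)
    (Q : S → X → ℝ) (R : Y → Sh → ℝ) : ℝ :=
  ∑ s, ∑ x, ∑ y, ∑ sh, κ s x y sh * (P s * Q s x * W x y * R y sh)

/-- Expected loss of the deterministic code with encoder `f` and decoder `g`. -/
noncomputable def codeLoss [Fintype S] [Fintype Y]
    (P : S → ℝ) (W : X → Y → ℝ) (κ : S → X → Y → Sh → ℝ)
    (f : S → X) (g : Y → Sh) : ℝ :=
  ∑ s, ∑ y, P s * W (f s) y * κ s (f s) y (g y)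

/-- Optimal value of problem SC (over randomized codes). -/
noncomputable def optSC [Fintype S] [Fintype X] [Fintype Y] [Fintype Sh]
    (P : S → ℝ) (W : X → Y → ℝ) (κ : S → X → Y → Sh → ℝ) : EReal :=
  ⨅ (Q : S → X → ℝ) (_ : IsKernel Q) (R : Y → Sh → ℝ) (_ : IsKernel R),
    ((expectedLoss P W κ Q R : ℝ) : EReal)

/-- The variables of the dual program DP. -/
structure DualPoint (S X Y Sh : Type*) where
  γa : S → ℝ
  γb : Y → ℝ
  lama : S → Sh → Y → ℝ
  lamb : X → S → Y → ℝ
  mu : S → X → Y → Sh → ℝ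

/-- The constraints of DP. -/
structure DualPoint.Feasible [Fintype S] [Fintype X] [Fintype Y] [Fintype Sh]
    (P : S → ℝ) (W : X → Y → ℝ) (κ : S → X → Y → Sh → ℝ)
    (p : DualPoint S X Y Sh) : Prop where
  d1 : ∀ x s, p.γa s - ∑ y, p.lamb x s y - ∑ sh, ∑ y, p.mu s x y sh ≤ 0
  d2 : ∀ sh y, p.γb y - ∑ s, p.lama s sh y - ∑ x, ∑ s, p.mu s x y sh ≤ 0
  d3 : ∀ s x y sh, p.lama s sh y + p.lamb x s y + p.mu s x y sh ≤ κ s x y sh * P s * W x y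
  mu_nonneg : ∀ s x y sh, 0 ≤ p.mu s x y sh

/-- The objective of DP. -/
noncomputable def DualPoint.objective [Fintype S] [Fintype X] [Fintype Y] [Fintype Sh]
    (p : DualPoint S X Y Sh) : ℝ :=
  ∑ s, p.γa s + ∑ y, p.γb y - ∑ s, ∑ x, ∑ y, ∑ sh, p.mu s x y sh

/-- Optimal value of the dual program DP. -/
noncomputable def optDP [Fintype S] [Fintype X] [Fintype Y] [Fintype Sh]
    (P : S → ℝ) (W : X → Y → ℝ) (κ : S → X → Y → Sh → ℝ) : EReal :=
  ⨆ (p : DualPoint S X Y Sh) (_ : p.Feasible P W κ), ((p.objective : ℝ) : EReal)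

/-- The loss `𝕀{d(s, ŝ) > D}` whose expectation is the excess distortion probability. -/
noncomputable def excessLoss (X Y : Type*) (d : S → Sh → ℝ≥0∞) (D : ℝ≥0) :
    S → X → Y → Sh → ℝ :=
  fun s _ _ sh => ind ((D : ℝ≥0∞) < d s sh)

/-! ### Rate-distortion function and tilted information (natural logarithms) -/

/-- The output distribution of the test channel `K` under the source `P`. -/
noncomputable def outputDist [Fintype S] (P : S → ℝ) (K : S → Sh → ℝ) (sh : Sh) : ℝ :=
  ∑ s, P s * K s sh

/-- `I(S; Ŝ)` in nats; summands with `P s * K s sh = 0` vanish. -/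
noncomputable def mutualInfo [Fintype S] [Fintype Sh] (P : S → ℝ) (K : S → Sh → ℝ) : ℝ :=
  ∑ s, ∑ sh, P s * K s sh * Real.log (K s sh / outputDist P K sh)

/-- `𝔼[d(S, Ŝ)] ∈ [0, ∞]`, with `0 * ∞ = 0`. -/
noncomputable def expectedDistortion [Fintype S] [Fintype Sh] (P : S → ℝ)
    (d : S → Sh → ℝ≥0∞) (K : S → Sh → ℝ) : ℝ≥0∞ :=
  ∑ s, ∑ sh, ENNReal.ofReal (P s * K s sh) * d s sh

/-- `K` is a test channel with expected distortion at most `D`. -/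
def IsTestChannel [Fintype S] [Fintype Sh] (P : S → ℝ) (d : S → Sh → ℝ≥0∞) (D : ℝ)
    (K : S → Sh → ℝ) : Prop :=
  IsKernel K ∧ (expectedDistortion P d K : EReal) ≤ (D : EReal)

/-- The rate-distortion function; it is `⊤` where there is no test channel. -/
noncomputable def rateDistortion [Fintype S] [Fintype Sh] (P : S → ℝ)
    (d : S → Sh → ℝ≥0∞) (D : ℝ) : EReal :=
  ⨅ (K : S → Sh → ℝ) (_ : IsTestChannel P d D K), ((mutualInfo P K : ℝ) : EReal)

/-- `d_min = inf {D : R(D) < ∞}`. -/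
noncomputable def dMin [Fintype S] [Fintype Sh] (P : S → ℝ) (d : S → Sh → ℝ≥0∞) : EReal :=
  ⨅ (D : ℝ) (_ : rateDistortion P d D < ⊤), (D : EReal)

/-- The test channel `K` achieves the infimum in the rate-distortion function. -/
def IsOptimalTestChannel [Fintype S] [Fintype Sh] (P : S → ℝ) (d : S → Sh → ℝ≥0∞) (D : ℝ)
    (K : S → Sh → ℝ) : Prop :=
  IsTestChannel P d D K ∧ ((mutualInfo P K : ℝ) : EReal) = rateDistortion P d D

open Classical in
/-- The optimal test channel, when there is one (otherwise an irrelevant value). -/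
noncomputable def optimalTestChannel [Fintype S] [Fintype Sh] (P : S → ℝ)
    (d : S → Sh → ℝ≥0∞) (D : ℝ) : S → Sh → ℝ :=
  if h : ∃ K, IsOptimalTestChannel P d D K then h.choose else fun _ _ => 0

/-- `λ* = -R'(D)`. -/
noncomputable def lamStar [Fintype S] [Fintype Sh] (P : S → ℝ)
    (d : S → Sh → ℝ≥0∞) (D : ℝ) : ℝ :=
  - deriv (fun r : ℝ => (rateDistortion P d r).toReal) D

/-- `exp(l * D - l * δ)` for `l > 0` and `δ ∈ [0, ∞]`, with `exp(-∞) = 0`. -/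
noncomputable def expTilt (l D : ℝ) (δ : ℝ≥0∞) : ℝ :=
  open Classical in if δ = ⊤ then 0 else Real.exp (l * D - l * δ.toReal)

/-- The tilted information `j_S(s, D)`; at `D = 0` it is the information `log (1 / P s)`. -/
noncomputable def tiltedInfo [Fintype S] [Fintype Sh] (P : S → ℝ)
    (d : S → Sh → ℝ≥0∞) (D : ℝ≥0) (s : S) : ℝ :=
  open Classical in
  if D = 0 then Real.log (1 / P s)
  else Real.log (1 / ∑ sh, outputDist P (optimalTestChannel P d D) sh *
    expTilt (lamStar P d D) D (d s sh))

/-- The standing assumptions under which the tilted information is defined at `D > d_min`.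
Uniqueness of the optimal test channel is required only at source symbols of positive
probability, as its value elsewhere is arbitrary. -/
structure TiltedRegular [Fintype S] [Fintype Sh] (P : S → ℝ)
    (d : S → Sh → ℝ≥0∞) (D : ℝ≥0) : Prop where
  dMin_lt : dMin P d < ((D : ℝ) : EReal)
  exists_optimal : ∃ K, IsOptimalTestChannel P d D K
  unique_optimal : ∀ K K', IsOptimalTestChannel P d D K → IsOptimalTestChannel P d D K' →
    ∀ s, P s ≠ 0 → K s = K' s
  differentiable : DifferentiableAt ℝ (fun r : ℝ => (rateDistortion P d r).toReal) D
  lamStar_pos : 0 < lamStar P d D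

/-! ### The auxiliary variables and the two converse bounds -/

/-- A random variable `V` with values in a set of size `T`, jointly distributed with the
channel `W` (so `∑ t, P(y|x,t) P(t|x) = W(y|x)`), and a distribution `PYbar t` on the output
alphabet for each `t`, dominating each `P(·|x,t)`. -/
structure Auxiliary [Fintype Y] (W : X → Y → ℝ) (T : ℕ) where
  PV : X → Fin T → ℝ
  PYV : X → Fin T → Y → ℝ
  PYbar : Fin T → Y → ℝ
  PV_kernel : IsKernel PV
  PYV_kernel : ∀ x, IsKernel (PYV x)
  PYbar_kernel : IsKernel PYbar
  channel_eq : ∀ x y, W x y = ∑ t, PYV x t y * PV x t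
  dominated : ∀ x t y, PYbar t y = 0 → PYV x t y = 0

/-- The information density `log (P(y|x,t) / Pbar(y|t))`, with `log 0 = -∞`. -/
noncomputable def infoDensity [Fintype Y] {W : X → Y → ℝ} {T : ℕ} (A : Auxiliary W T)
    (x : X) (y : Y) (t : Fin T) : EReal :=
  ENNReal.log (ENNReal.ofReal (A.PYV x t y) / ENNReal.ofReal (A.PYbar t y))

/-- `ℙ[j - i(x; Y | V) ≥ γ]` with `(V, Y)` distributed as `P(t|x) P(y|x,t)`. -/
noncomputable def probTerm [Fintype Y] {W : X → Y → ℝ} {T : ℕ} (A : Auxiliary W T)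
    (j γ : ℝ) (x : X) : ℝ :=
  ∑ y, ∑ t, A.PV x t * A.PYV x t y * ind ((γ : EReal) ≤ (j : EReal) - infoDensity A x y t)

/-- `exp(j - γ) ∑_y ∑_t P(t|x) Pbar(y|t) 𝕀{i(x; y | t) > j - γ}`. -/
noncomputable def extraTerm [Fintype Y] {W : X → Y → ℝ} {T : ℕ} (A : Auxiliary W T)
    (j γ : ℝ) (x : X) : ℝ :=
  Real.exp (j - γ) *
    ∑ y, ∑ t, A.PV x t * A.PYbar t y * ind (((j - γ : ℝ) : EReal) < infoDensity A x y t)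

/-- The expectation over the source that is common to both bounds. -/
noncomputable def mainTerm [Fintype S] [Fintype Y] [Fintype Sh] (P : S → ℝ)
    (d : S → Sh → ℝ≥0∞) (D : ℝ≥0) (γ : ℝ) {W : X → Y → ℝ} {T : ℕ} (A : Auxiliary W T) : ℝ :=
  ∑ s, P s * ⨅ x, (probTerm A (tiltedInfo P d D s) γ x + extraTerm A (tiltedInfo P d D s) γ x)

/-- `𝔼[exp(j_S(S, D) - γ) 𝕀{d(S, ŝ) ≤ D}]`. -/
noncomputable def coverTerm [Fintype S] [Fintype Sh] (P : S → ℝ)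
    (d : S → Sh → ℝ≥0∞) (D : ℝ≥0) (γ : ℝ) (sh : Sh) : ℝ :=
  ∑ s, P s * (Real.exp (tiltedInfo P d D s - γ) * ind (d s sh ≤ (D : ℝ≥0∞)))

/-- The earlier bound at given parameters. -/
noncomputable def oldValue [Fintype S] [Fintype Y] [Fintype Sh] (P : S → ℝ)
    (d : S → Sh → ℝ≥0∞) (D : ℝ≥0) (γ : ℝ) {W : X → Y → ℝ} {T : ℕ} (A : Auxiliary W T) : ℝ :=
  mainTerm P d D γ A - T * Real.exp (-γ)

/-- The improved bound at given parameters. -/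
noncomputable def newValue [Fintype S] [Fintype Y] [Fintype Sh] (P : S → ℝ)
    (d : S → Sh → ℝ≥0∞) (D : ℝ≥0) (γ : ℝ) {W : X → Y → ℝ} {T : ℕ} (A : Auxiliary W T) : ℝ :=
  mainTerm P d D γ A - T * ⨆ sh, coverTerm P d D γ sh

/-- The earlier converse: supremum over `γ`, `T` and the auxiliary variables. -/
noncomputable def oldBound [Fintype S] [Fintype Y] [Fintype Sh] (P : S → ℝ)
    (W : X → Y → ℝ) (d : S → Sh → ℝ≥0∞) (D : ℝ≥0) : EReal :=
  ⨆ (γ : ℝ) (T : ℕ) (_ : 0 < T) (A : Auxiliary W T), ((oldValue P d D γ A : ℝ) : EReal)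

/-- The improved converse: supremum over `γ`, `T` and the auxiliary variables. -/
noncomputable def newBound [Fintype S] [Fintype Y] [Fintype Sh] (P : S → ℝ)
    (W : X → Y → ℝ) (d : S → Sh → ℝ≥0∞) (D : ℝ≥0) : EReal :=
  ⨆ (γ : ℝ) (T : ℕ) (_ : 0 < T) (A : Auxiliary W T), ((newValue P d D γ A : ℝ) : EReal)

/-! ### The dual variables -/

noncomputable def dualLamb [Fintype S] [Fintype Y] [Fintype Sh] (P : S → ℝ)
    (d : S → Sh → ℝ≥0∞) (D : ℝ≥0) (γ : ℝ) {W : X → Y → ℝ} {T : ℕ} (A : Auxiliary W T)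
    (x : X) (s : S) (y : Y) : ℝ :=
  P s * ∑ t,
    (A.PYV x t y * A.PV x t *
        ind (A.PYV x t y ≤ A.PYbar t y * Real.exp (tiltedInfo P d D s - γ)) +
      A.PYbar t y * Real.exp (tiltedInfo P d D s - γ) * A.PV x t *
        ind (A.PYbar t y * Real.exp (tiltedInfo P d D s - γ) < A.PYV x t y))

noncomputable def dualLama [Fintype S] [Fintype Y] [Fintype Sh] (P : S → ℝ)
    (d : S → Sh → ℝ≥0∞) (D : ℝ≥0) (γ : ℝ) {W : X → Y → ℝ} {T : ℕ} (A : Auxiliary W T)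
    (s : S) (sh : Sh) (y : Y) : ℝ :=
  -(P s * Real.exp (tiltedInfo P d D s - γ) * ind (d s sh ≤ (D : ℝ≥0∞)) * ∑ t, A.PYbar t y)

/-- The dual point with `γa s = inf_x ∑_y λb`, `γb y = min_ŝ ∑_s λa` and `μ = 0`. -/
noncomputable def dualPoint [Fintype S] [Fintype Y] [Fintype Sh] (P : S → ℝ)
    (d : S → Sh → ℝ≥0∞) (D : ℝ≥0) (γ : ℝ) {W : X → Y → ℝ} {T : ℕ} (A : Auxiliary W T) :
    DualPoint S X Y Sh where
  γa s := ⨅ x, ∑ y, dualLamb P d D γ A x s y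
  γb y := ⨅ sh, ∑ s, dualLama P d D γ A s sh y
  lama := dualLama P d D γ A
  lamb := dualLamb P d D γ A
  mu := fun _ _ _ _ => 0

end

end JSCC

open JSCC

/-! The chain of bounds is linear-programming weak duality plus the evaluation of one dual point.
For weak duality, D1 is averaged with the encoder, D2 with the decoder and D3 with the product of
the two.

Each summand of `dualLamb` is `P s * PV` times the minimum of `PYV` and `PYbar * exp(j - γ)`. A
minimum lies below both of its arguments. The first gives D3 where the distortion exceeds `D`; the
second gives it elsewhere, where the negative `dualLama` compensates. Summation over outputs turns
this point into `mainTerm` minus `T` times the supremum of `coverTerm`.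

The improvement amounts to `coverTerm ≤ exp(-γ)`, that is, `𝔼[exp(j) 𝕀{d(S, ŝ) ≤ D}] ≤ 1` for every
`ŝ`. At `D = 0` this is counting. For `D > 0` the indicator is at most `exp(λ*(D - d))`, and what
remains is the Kuhn-Tucker condition of the rate-distortion problem. Convexity of mutual information
and differentiability of the rate-distortion function show that the optimal channel minimizes the
Lagrangian with multiplier `λ*`. By the variational form of the Lagrangian, `𝔼[log Z_q(S)]`, with
`Z_q` the tilted partition function of the output law `q`, cannot grow when the optimal `q` moves
towards the point mass at `ŝ`. The one-sided derivative of this quantity is the condition. -/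

namespace JSCC

/-! ### Weak duality between codes and dual points -/

section WeakDuality

variable {S X Y Sh : Type*} [Fintype S] [Fintype X] [Fintype Y] [Fintype Sh]

/-- Weak duality for a pair of a dual feasible point and a randomized code. -/
theorem DualPoint.Feasible.objective_le_expectedLoss {P : S → ℝ} {W : X → Y → ℝ}
    {κ : S → X → Y → Sh → ℝ} {p : DualPoint S X Y Sh} (hp : p.Feasible P W κ)
    {Q : S → X → ℝ} {R : Y → Sh → ℝ} (hQ : IsKernel Q) (hR : IsKernel R) :
    p.objective ≤ expectedLoss P W κ Q R := by
  have ha : ∑ s, p.γa s ≤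
      ∑ s, ∑ x, Q s x * (∑ y, p.lamb x s y + ∑ y, ∑ sh, p.mu s x y sh) := by
    refine Finset.sum_le_sum fun s _ => ?_
    calc p.γa s = ∑ x, Q s x * p.γa s := by rw [← Finset.sum_mul, (hQ s).2, one_mul]
      _ ≤ _ := by
        refine Finset.sum_le_sum fun x _ => mul_le_mul_of_nonneg_left ?_ ((hQ s).1 x)
        have := hp.d1 x s
        rw [Finset.sum_comm (f := fun sh y => p.mu s x y sh)] at this
        linarith
  have hb : ∑ y, p.γb y ≤
      ∑ y, ∑ sh, R y sh * (∑ s, p.lama s sh y + ∑ s, ∑ x, p.mu s x y sh) := by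
    refine Finset.sum_le_sum fun y _ => ?_
    calc p.γb y = ∑ sh, R y sh * p.γb y := by rw [← Finset.sum_mul, (hR y).2, one_mul]
      _ ≤ _ := by
        refine Finset.sum_le_sum fun sh _ => mul_le_mul_of_nonneg_left ?_ ((hR y).1 sh)
        have := hp.d2 sh y
        rw [Finset.sum_comm (f := fun x s => p.mu s x y sh)] at this
        linarith
  -- `mu` enters with weight `Q` from D1, `R` from D2 and `-1` from the objective, hence the
  -- coefficient `Q + R - 1`.
  have hl : ∑ s, ∑ x, ∑ y, ∑ sh, (Q s x * R y sh * (p.lama s sh y + p.lamb x s y) +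
      (Q s x + R y sh - 1) * p.mu s x y sh) ≤ expectedLoss P W κ Q R := by
    refine Finset.sum_le_sum fun s _ => Finset.sum_le_sum fun x _ =>
      Finset.sum_le_sum fun y _ => Finset.sum_le_sum fun sh _ => ?_
    have hQ1 : Q s x ≤ 1 := (hQ s).2 ▸ Finset.single_le_sum (fun i _ => (hQ s).1 i)
      (Finset.mem_univ x)
    have hR1 : R y sh ≤ 1 := (hR y).2 ▸ Finset.single_le_sum (fun i _ => (hR y).1 i)
      (Finset.mem_univ sh)
    have h1 := mul_le_mul_of_nonneg_left (hp.d3 s x y sh) (mul_nonneg ((hQ s).1 x) ((hR y).1 sh))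
    -- `(1 - Q)(1 - R) ≥ 0` says `Q + R - 1 ≤ Q * R`, the weight that D3 gives to `mu`.
    have h2 := mul_nonneg (mul_nonneg (sub_nonneg.2 hQ1) (sub_nonneg.2 hR1))
      (hp.mu_nonneg s x y sh)
    linarith
  have hlama : ∑ s, ∑ x, ∑ y, ∑ sh, Q s x * R y sh * p.lama s sh y =
      ∑ y, ∑ sh, R y sh * ∑ s, p.lama s sh y := by
    calc _ = ∑ s, ∑ x, Q s x * ∑ y, ∑ sh, R y sh * p.lama s sh y := by
          simp only [Finset.mul_sum, mul_assoc]
      _ = ∑ s, ∑ y, ∑ sh, R y sh * p.lama s sh y := by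
          refine Finset.sum_congr rfl fun s _ => ?_
          rw [← Finset.sum_mul, (hQ s).2, one_mul]
      _ = _ := by
          rw [Finset.sum_comm]
          refine Finset.sum_congr rfl fun y _ => ?_
          rw [Finset.sum_comm]
          simp only [Finset.mul_sum]
  have hlamb : ∑ s, ∑ x, ∑ y, ∑ sh, Q s x * R y sh * p.lamb x s y =
      ∑ s, ∑ x, Q s x * ∑ y, p.lamb x s y := by
    refine Finset.sum_congr rfl fun s _ => Finset.sum_congr rfl fun x _ => ?_
    rw [Finset.mul_sum]
    refine Finset.sum_congr rfl fun y _ => ?_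
    rw [← Finset.sum_mul, ← Finset.mul_sum, (hR y).2, mul_one]
  have hmuQ : ∑ s, ∑ x, ∑ y, ∑ sh, Q s x * p.mu s x y sh =
      ∑ s, ∑ x, Q s x * ∑ y, ∑ sh, p.mu s x y sh := by
    simp only [Finset.mul_sum]
  have hmuR : ∑ s, ∑ x, ∑ y, ∑ sh, R y sh * p.mu s x y sh =
      ∑ y, ∑ sh, R y sh * ∑ s, ∑ x, p.mu s x y sh := by
    simp only [Finset.mul_sum]
    calc _ = ∑ s, ∑ y, ∑ x, ∑ sh, R y sh * p.mu s x y sh :=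
          Finset.sum_congr rfl fun s _ => Finset.sum_comm
      _ = ∑ y, ∑ s, ∑ x, ∑ sh, R y sh * p.mu s x y sh := Finset.sum_comm
      _ = ∑ y, ∑ s, ∑ sh, ∑ x, R y sh * p.mu s x y sh :=
          Finset.sum_congr rfl fun y _ => Finset.sum_congr rfl fun s _ => Finset.sum_comm
      _ = _ := Finset.sum_congr rfl fun y _ => Finset.sum_comm
  simp only [mul_add, sub_mul, add_mul, one_mul, Finset.sum_add_distrib,
    Finset.sum_sub_distrib] at ha hb hl
  unfold DualPoint.objective
  linarith

theorem optDP_le_optSC (P : S → ℝ) (W : X → Y → ℝ) (κ : S → X → Y → Sh → ℝ) :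
    optDP P W κ ≤ optSC P W κ :=
  iSup₂_le fun _ hp => le_iInf₂ fun _ hQ => le_iInf₂ fun _ hR =>
    EReal.coe_le_coe_iff.2 (hp.objective_le_expectedLoss hQ hR)

theorem optSC_le_expectedLoss (P : S → ℝ) (W : X → Y → ℝ) (κ : S → X → Y → Sh → ℝ)
    {Q : S → X → ℝ} {R : Y → Sh → ℝ} (hQ : IsKernel Q) (hR : IsKernel R) :
    optSC P W κ ≤ ((expectedLoss P W κ Q R : ℝ) : EReal) :=
  (iInf₂_le Q hQ).trans (iInf₂_le R hR)

open Classical in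
theorem isKernel_single {A B : Type*} [Fintype B] (f : A → B) :
    IsKernel fun a => Pi.single (f a) (1 : ℝ) :=
  fun a => single_mem_stdSimplex ℝ (f a)

open Classical in
theorem expectedLoss_single (P : S → ℝ) (W : X → Y → ℝ) (κ : S → X → Y → Sh → ℝ)
    (f : S → X) (g : Y → Sh) :
    expectedLoss P W κ (fun s => Pi.single (f s) 1) (fun y => Pi.single (g y) 1) =
      codeLoss P W κ f g := by
  unfold expectedLoss codeLoss
  refine Finset.sum_congr rfl fun s _ => ?_
  rw [Finset.sum_eq_single (f s) (fun x _ hx => by simp [Pi.single_eq_of_ne hx]) (by simp)]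
  refine Finset.sum_congr rfl fun y _ => ?_
  rw [Finset.sum_eq_single (g y) (fun x _ hx => by simp [Pi.single_eq_of_ne hx]) (by simp)]
  simp [mul_comm]

theorem optSC_le_codeLoss (P : S → ℝ) (W : X → Y → ℝ) (κ : S → X → Y → Sh → ℝ)
    (f : S → X) (g : Y → Sh) : optSC P W κ ≤ ((codeLoss P W κ f g : ℝ) : EReal) := by
  classical
  rw [← expectedLoss_single]
  exact optSC_le_expectedLoss P W κ (isKernel_single f) (isKernel_single g)

end WeakDuality

/-! ### Feasibility and value of the explicit dual point -/

section DualPoint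

variable {S X Y Sh : Type*}

theorem ind_of {p : Prop} (h : p) : ind p = 1 := by simp [ind, h]

theorem ind_of_not {p : Prop} (h : ¬p) : ind p = 0 := by simp [ind, h]

theorem infoDensity_le_iff [Fintype Y] {W : X → Y → ℝ} {T : ℕ} (A : Auxiliary W T)
    (x : X) (y : Y) (t : Fin T) (h : A.PYbar t y ≠ 0) (c : ℝ) :
    infoDensity A x y t ≤ (c : EReal) ↔ A.PYV x t y ≤ A.PYbar t y * Real.exp c := by
  have hb : 0 < A.PYbar t y := lt_of_le_of_ne ((A.PYbar_kernel t).1 y) h.symm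
  have ha : 0 ≤ A.PYV x t y := (A.PYV_kernel x t).1 y
  have hc : (c : EReal) = ENNReal.log (ENNReal.ofReal (Real.exp c)) := by
    rw [ENNReal.log_ofReal_of_pos (Real.exp_pos c), Real.log_exp]
  rw [infoDensity, hc, ENNReal.log_le_log_iff, ← ENNReal.ofReal_div_of_pos hb,
    ENNReal.ofReal_le_ofReal_iff (Real.exp_pos c).le, div_le_iff₀ hb, mul_comm]

/-- Since `j` is finite, no `∞ - ∞` arises: information density `-∞` satisfies both sides and `+∞`
neither. -/
theorem EReal_coe_le_coe_sub_iff (γ j : ℝ) (i : EReal) :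
    (γ : EReal) ≤ (j : EReal) - i ↔ i ≤ ((j - γ : ℝ) : EReal) := by
  induction i with
  | bot => simp
  | top => simpa using EReal.coe_ne_top (j - γ)
  | coe i =>
    norm_cast
    constructor <;> intro h <;> linarith

/-- The threshold `PYV ≤ PYbar * exp(j - γ)` is the event `j - i ≥ γ`, and its complement is the
event in `extraTerm`; the two halves of `dualLamb` match these two terms. -/
theorem sum_dualLamb [Fintype S] [Fintype Y] [Fintype Sh] (P : S → ℝ)
    (d : S → Sh → ℝ≥0∞) (D : ℝ≥0) (γ : ℝ) {W : X → Y → ℝ} {T : ℕ} (A : Auxiliary W T)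
    (x : X) (s : S) :
    ∑ y, dualLamb P d D γ A x s y =
      P s * (probTerm A (tiltedInfo P d D s) γ x + extraTerm A (tiltedInfo P d D s) γ x) := by
  simp only [dualLamb, probTerm, extraTerm]
  rw [← Finset.mul_sum]
  congr 1
  simp only [Finset.mul_sum, Finset.sum_add_distrib]
  rw [← Finset.sum_add_distrib, ← Finset.sum_add_distrib]
  refine Finset.sum_congr rfl fun y _ => ?_
  rw [← Finset.sum_add_distrib, ← Finset.sum_add_distrib]
  refine Finset.sum_congr rfl fun t _ => ?_
  by_cases h : A.PYbar t y = 0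
  -- Domination makes `PYV` vanish with `PYbar`, so every product is zero whatever the indicators
  -- say.
  · simp [h, A.dominated x t y h]
  · rw [EReal_coe_le_coe_sub_iff, ← not_le (a := infoDensity A x y t),
      infoDensity_le_iff A x y t h, not_le]
    ring

theorem sum_dualLama [Fintype S] [Fintype Y] [Fintype Sh] (P : S → ℝ)
    (d : S → Sh → ℝ≥0∞) (D : ℝ≥0) (γ : ℝ) {W : X → Y → ℝ} {T : ℕ} (A : Auxiliary W T)
    (sh : Sh) (y : Y) :
    ∑ s, dualLama P d D γ A s sh y = (-∑ t, A.PYbar t y) * coverTerm P d D γ sh := by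
  simp only [dualLama, coverTerm]
  rw [Finset.mul_sum]
  exact Finset.sum_congr rfl fun s _ => by ring

/-- The summands of `dualLamb` are minima. If `d ≤ D`, bounding by `PYbar * e` and `PV ≤ 1` is paid
for exactly by `dualLama`. If `d > D`, `dualLama` vanishes and bounding by `PYV` recovers the
channel `W` after summation over `t`. -/
theorem dualLama_add_dualLamb_le [Fintype S] [Fintype Y] [Fintype Sh] {P : S → ℝ}
    (hP : P ∈ stdSimplex ℝ S) (d : S → Sh → ℝ≥0∞) (D : ℝ≥0) (γ : ℝ) {W : X → Y → ℝ} {T : ℕ}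
    (A : Auxiliary W T) (s : S) (x : X) (y : Y) (sh : Sh) :
    dualLama P d D γ A s sh y + dualLamb P d D γ A x s y ≤
      excessLoss X Y d D s x y sh * P s * W x y := by
  have hPs := hP.1 s
  have hV t : 0 ≤ A.PV x t := (A.PV_kernel x).1 t
  have hV1 t : A.PV x t ≤ 1 := (A.PV_kernel x).2 ▸ Finset.single_le_sum
    (fun i _ => (A.PV_kernel x).1 i) (Finset.mem_univ t)
  have hb t : 0 ≤ A.PYbar t y := (A.PYbar_kernel t).1 y
  set e := Real.exp (tiltedInfo P d D s - γ) with he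
  have he0 : 0 < e := Real.exp_pos _
  by_cases h : d s sh ≤ (D : ℝ≥0∞)
  · simp only [dualLama, dualLamb, excessLoss, ind_of h, ind_of_not (not_lt.2 h), ← he]
    have : ∑ t, (A.PYV x t y * A.PV x t * ind (A.PYV x t y ≤ A.PYbar t y * e) +
        A.PYbar t y * e * A.PV x t * ind (A.PYbar t y * e < A.PYV x t y)) ≤
        ∑ t, e * A.PYbar t y := by
      refine Finset.sum_le_sum fun t _ => ?_
      have h0 : A.PYbar t y * e * A.PV x t ≤ e * A.PYbar t y :=
        (mul_le_of_le_one_right (mul_nonneg (hb t) he0.le) (hV1 t)).trans_eq (mul_comm _ _)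
      rcases le_or_gt (A.PYV x t y) (A.PYbar t y * e) with h1 | h1
      · rw [ind_of h1, ind_of_not (not_lt.2 h1)]
        linarith [mul_le_mul_of_nonneg_right h1 (hV t)]
      · rw [ind_of h1, ind_of_not (not_le.2 h1)]
        linarith
    rw [← Finset.mul_sum] at this
    linarith [mul_le_mul_of_nonneg_left this hPs]
  · simp only [dualLama, dualLamb, excessLoss, ind_of_not h, ind_of (not_le.1 h), ← he]
    rw [A.channel_eq x y]
    have : ∑ t, (A.PYV x t y * A.PV x t * ind (A.PYV x t y ≤ A.PYbar t y * e) +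
        A.PYbar t y * e * A.PV x t * ind (A.PYbar t y * e < A.PYV x t y)) ≤
        ∑ t, A.PYV x t y * A.PV x t := by
      refine Finset.sum_le_sum fun t _ => ?_
      rcases le_or_gt (A.PYV x t y) (A.PYbar t y * e) with h1 | h1
      · rw [ind_of h1, ind_of_not (not_lt.2 h1)]
        linarith
      · rw [ind_of h1, ind_of_not (not_le.2 h1)]
        linarith [mul_le_mul_of_nonneg_right h1.le (hV t)]
    linarith [mul_le_mul_of_nonneg_left this hPs]

theorem dualPoint_feasible [Fintype S] [Fintype X] [Fintype Y] [Fintype Sh] {P : S → ℝ}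
    (hP : P ∈ stdSimplex ℝ S) (d : S → Sh → ℝ≥0∞) (D : ℝ≥0) (γ : ℝ) {W : X → Y → ℝ} {T : ℕ}
    (A : Auxiliary W T) : (dualPoint P d D γ A).Feasible P W (excessLoss X Y d D) where
  d1 x s := by
    have := ciInf_le (Finite.bddBelow_range fun x => ∑ y, dualLamb P d D γ A x s y) x
    simpa [dualPoint] using this
  d2 sh y := by
    have := ciInf_le (Finite.bddBelow_range fun sh => ∑ s, dualLama P d D γ A s sh y) sh
    simpa [dualPoint] using this
  d3 s x y sh := by
    simpa [dualPoint] using dualLama_add_dualLamb_le hP d D γ A s x y sh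
  mu_nonneg _ _ _ _ := le_rfl

theorem dualPoint_objective [Fintype S] [Fintype X] [Fintype Y] [Fintype Sh] {P : S → ℝ}
    (hP : P ∈ stdSimplex ℝ S) (d : S → Sh → ℝ≥0∞) (D : ℝ≥0) (γ : ℝ) {W : X → Y → ℝ} {T : ℕ}
    (A : Auxiliary W T) : (dualPoint P d D γ A).objective = newValue P d D γ A := by
  have hb : ∑ y, ⨅ sh, ∑ s, dualLama P d D γ A s sh y = -(T * ⨆ sh, coverTerm P d D γ sh) := by
    have hy y : ⨅ sh, ∑ s, dualLama P d D γ A s sh y =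
        (-∑ t, A.PYbar t y) * ⨆ sh, coverTerm P d D γ sh := by
      simp only [sum_dualLama]
      -- The nonpositive factor turns the minimum over `ŝ` into a supremum of `coverTerm`. Summed
      -- over `y`, the factors give `-T`, one unit for each law `PYbar t`.
      exact (Real.mul_iSup_of_nonpos
        (neg_nonpos.2 (Finset.sum_nonneg fun t _ => (A.PYbar_kernel t).1 y)) _).symm
    simp only [hy]
    rw [← Finset.sum_mul, Finset.sum_neg_distrib, Finset.sum_comm]
    simp only [(A.PYbar_kernel _).2]
    simp
  have ha s : ⨅ x, ∑ y, dualLamb P d D γ A x s y =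
      P s * ⨅ x, (probTerm A (tiltedInfo P d D s) γ x + extraTerm A (tiltedInfo P d D s) γ x) := by
    simp only [sum_dualLamb]
    exact (Real.mul_iInf_of_nonneg (hP.1 s) _).symm
  simp only [DualPoint.objective, dualPoint, newValue, mainTerm, ha, hb, Finset.sum_const_zero]
  ring

theorem le_dualPoint_γb [Fintype S] [Fintype X] [Fintype Y] [Fintype Sh] [Nonempty Sh]
    {P : S → ℝ} {d : S → Sh → ℝ≥0∞} {D : ℝ≥0} {γ : ℝ} {W : X → Y → ℝ} {T : ℕ}
    {A : Auxiliary W T} {γb : Y → ℝ} (h : DualPoint.Feasible P W (excessLoss X Y d D)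
      { dualPoint P d D γ A with γb := γb }) (y : Y) :
    γb y ≤ (dualPoint P d D γ A).γb y := by
  refine le_ciInf fun sh => ?_
  simpa [dualPoint] using h.d2 sh y

theorem newBound_le_optDP [Fintype S] [Fintype X] [Fintype Y] [Fintype Sh] {P : S → ℝ}
    (hP : P ∈ stdSimplex ℝ S) (W : X → Y → ℝ) (d : S → Sh → ℝ≥0∞) (D : ℝ≥0) :
    newBound P W d D ≤ optDP P W (excessLoss X Y d D) := by
  refine iSup₂_le fun γ T => iSup₂_le fun _ A => ?_
  rw [← dualPoint_objective hP]
  exact le_iSup₂_of_le _ (dualPoint_feasible hP d D γ A) le_rfl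

end DualPoint

/-! ### Entropy inequalities and convexity of mutual information -/

section RateDistortion

variable {S Sh : Type*}

/-- Tangent line bound for `a log (a / b)`. -/
theorem tangent_le_mul_log_div {a b c : ℝ} (ha : 0 ≤ a) (hb : 0 ≤ b) (hab : b = 0 → a = 0)
    (hc : 0 < c) : a * Real.log c + a - b * c ≤ a * Real.log (a / b) := by
  rcases ha.eq_or_lt with rfl | ha
  · simpa using mul_nonneg hb hc.le
  have hb : 0 < b := lt_of_le_of_ne hb fun h => ha.ne' (hab h.symm)
  have h := Real.log_le_sub_one_of_pos (show 0 < c / (a / b) by positivity)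
  rw [Real.log_div hc.ne' (by positivity)] at h
  have h1 := mul_le_mul_of_nonneg_left h ha.le
  have h2 : a * (c / (a / b) - 1) = b * c - a := by field_simp
  linarith

/-- The log-sum inequality for two summands. -/
theorem add_mul_log_div_le {a₁ a₂ b₁ b₂ : ℝ} (ha₁ : 0 ≤ a₁) (ha₂ : 0 ≤ a₂) (hb₁ : 0 ≤ b₁)
    (hb₂ : 0 ≤ b₂) (h₁ : b₁ = 0 → a₁ = 0) (h₂ : b₂ = 0 → a₂ = 0) :
    (a₁ + a₂) * Real.log ((a₁ + a₂) / (b₁ + b₂)) ≤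
      a₁ * Real.log (a₁ / b₁) + a₂ * Real.log (a₂ / b₂) := by
  rcases (add_nonneg ha₁ ha₂).eq_or_lt with h | h
  · have e₁ : a₁ = 0 := by linarith
    have e₂ : a₂ = 0 := by linarith
    simp [e₁, e₂]
  have hb : 0 < b₁ + b₂ := by
    refine lt_of_le_of_ne (add_nonneg hb₁ hb₂) fun hb => h.ne' ?_
    rw [h₁ (by linarith), h₂ (by linarith), add_zero]
  have hc : 0 < (a₁ + a₂) / (b₁ + b₂) := div_pos h hb
  have t₁ := tangent_le_mul_log_div ha₁ hb₁ h₁ hc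
  have t₂ := tangent_le_mul_log_div ha₂ hb₂ h₂ hc
  have : (b₁ + b₂) * ((a₁ + a₂) / (b₁ + b₂)) = a₁ + a₂ := mul_div_cancel₀ _ hb.ne'
  linarith

variable [Fintype S] [Fintype Sh]

/-- The conditional relative entropy `D(K ‖ q | P)` in nats. -/
noncomputable def condDivergence (P : S → ℝ) (K : S → Sh → ℝ) (q : Sh → ℝ) : ℝ :=
  ∑ s, ∑ sh, P s * K s sh * Real.log (K s sh / q sh)

theorem outputDist_mem_stdSimplex {P : S → ℝ} (hP : P ∈ stdSimplex ℝ S) {K : S → Sh → ℝ}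
    (hK : IsKernel K) : outputDist P K ∈ stdSimplex ℝ Sh := by
  refine ⟨fun sh => Finset.sum_nonneg fun s _ => mul_nonneg (hP.1 s) ((hK s).1 sh), ?_⟩
  simp only [outputDist]
  rw [Finset.sum_comm]
  simp only [← Finset.mul_sum, (hK _).2, mul_one, hP.2]

theorem mul_eq_zero_of_outputDist_eq_zero {P : S → ℝ} (hP : P ∈ stdSimplex ℝ S)
    {K : S → Sh → ℝ} (hK : IsKernel K) {sh : Sh} (h : outputDist P K sh = 0) (s : S) :
    P s * K s sh = 0 :=
  (Finset.sum_eq_zero_iff_of_nonneg fun s _ => mul_nonneg (hP.1 s) ((hK s).1 sh)).1 h s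
    (Finset.mem_univ s)

theorem mutualInfo_nonneg {P : S → ℝ} (hP : P ∈ stdSimplex ℝ S) {K : S → Sh → ℝ}
    (hK : IsKernel K) : 0 ≤ mutualInfo P K := by
  have hq := outputDist_mem_stdSimplex hP hK
  have h : ∑ s, ∑ sh, (P s * K s sh - P s * outputDist P K sh) ≤ mutualInfo P K := by
    refine Finset.sum_le_sum fun s _ => Finset.sum_le_sum fun sh _ => ?_
    rcases (hP.1 s).eq_or_lt with h | h
    · simp [← h]
    · have := tangent_le_mul_log_div (c := 1) ((hK s).1 sh) (hq.1 sh) (fun h0 =>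
        (mul_eq_zero.1 (mul_eq_zero_of_outputDist_eq_zero hP hK h0 s)).resolve_left h.ne') one_pos
      simp only [Real.log_one, mul_zero, zero_add, mul_one] at this
      have := mul_le_mul_of_nonneg_left this h.le
      linarith
  simpa only [Finset.sum_sub_distrib, ← Finset.mul_sum, (hK _).2, hq.2, sub_self,
    Finset.sum_const_zero] using h

/-- The output distribution minimizes the conditional relative entropy. -/
theorem mutualInfo_le_condDivergence {P : S → ℝ} (hP : P ∈ stdSimplex ℝ S) {K : S → Sh → ℝ}
    (hK : IsKernel K) {q : Sh → ℝ} (hq : q ∈ stdSimplex ℝ Sh)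
    (hKq : ∀ s sh, q sh = 0 → P s * K s sh = 0) :
    mutualInfo P K ≤ condDivergence P K q := by
  have ho := outputDist_mem_stdSimplex hP hK
  have hoq sh (h : q sh = 0) : outputDist P K sh = 0 :=
    Finset.sum_eq_zero fun s _ => hKq s sh h
  have h1 : ∑ sh, (outputDist P K sh - q sh) ≤
      ∑ sh, outputDist P K sh * Real.log (outputDist P K sh / q sh) := by
    refine Finset.sum_le_sum fun sh _ => ?_
    simpa using tangent_le_mul_log_div (c := 1) (ho.1 sh) (hq.1 sh) (hoq sh) one_pos
  -- The excess is the relative entropy of the output law with respect to `q`, which `h1` bounds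
  -- below by zero.
  have h2 : condDivergence P K q - mutualInfo P K =
      ∑ sh, outputDist P K sh * Real.log (outputDist P K sh / q sh) := by
    have : ∀ sh, outputDist P K sh * Real.log (outputDist P K sh / q sh) =
        ∑ s, P s * K s sh * Real.log (outputDist P K sh / q sh) := fun sh => by
      rw [← Finset.sum_mul]; rfl
    simp only [this]
    rw [Finset.sum_comm, condDivergence, mutualInfo, ← Finset.sum_sub_distrib]
    refine Finset.sum_congr rfl fun s _ => ?_
    rw [← Finset.sum_sub_distrib]
    refine Finset.sum_congr rfl fun sh _ => ?_
    by_cases h : P s * K s sh = 0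
    · simp [h]
    have hq0 : q sh ≠ 0 := fun h0 => h (hKq s sh h0)
    have ho0 : outputDist P K sh ≠ 0 := fun h0 =>
      h (mul_eq_zero_of_outputDist_eq_zero hP hK h0 s)
    have hK0 := right_ne_zero_of_mul h
    rw [Real.log_div hK0 hq0, Real.log_div hK0 ho0, Real.log_div ho0 hq0]
    ring
  rw [Finset.sum_sub_distrib, ho.2, hq.2] at h1
  linarith

omit [Fintype S] in
/-- Mixtures of kernels. -/
theorem IsKernel.mix {K K' : S → Sh → ℝ} (hK : IsKernel K) (hK' : IsKernel K') {t : ℝ}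
    (ht : t ∈ Set.Icc (0 : ℝ) 1) : IsKernel fun s sh => (1 - t) * K s sh + t * K' s sh := fun s =>
  convex_stdSimplex ℝ Sh (hK s) (hK' s) (sub_nonneg.2 ht.2) ht.1 (by ring)

/-- Mutual information is convex in the channel. -/
theorem mutualInfo_mix_le {P : S → ℝ} (hP : P ∈ stdSimplex ℝ S) {K K' : S → Sh → ℝ}
    (hK : IsKernel K) (hK' : IsKernel K') {t : ℝ} (ht : t ∈ Set.Ioo (0 : ℝ) 1) :
    mutualInfo P (fun s sh => (1 - t) * K s sh + t * K' s sh) ≤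
      (1 - t) * mutualInfo P K + t * mutualInfo P K' := by
  have hr : 0 < 1 - t := sub_pos.2 ht.2
  have ho : ∀ sh, outputDist P (fun s sh => (1 - t) * K s sh + t * K' s sh) sh =
      (1 - t) * outputDist P K sh + t * outputDist P K' sh := fun sh => by
    simp only [outputDist, Finset.mul_sum]
    rw [← Finset.sum_add_distrib]
    exact Finset.sum_congr rfl fun s _ => by ring
  have hq := outputDist_mem_stdSimplex hP hK
  have hq' := outputDist_mem_stdSimplex hP hK'
  simp only [mutualInfo, ho, Finset.mul_sum]
  rw [← Finset.sum_add_distrib]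
  refine Finset.sum_le_sum fun s _ => ?_
  rw [← Finset.sum_add_distrib]
  refine Finset.sum_le_sum fun sh _ => ?_
  rcases (hP.1 s).eq_or_lt with h | h
  · simp [← h]
  have := add_mul_log_div_le (mul_nonneg hr.le ((hK s).1 sh)) (mul_nonneg ht.1.le ((hK' s).1 sh))
    (mul_nonneg hr.le (hq.1 sh)) (mul_nonneg ht.1.le (hq'.1 sh))
    (fun h0 => by
      have := mul_eq_zero_of_outputDist_eq_zero hP hK ((mul_eq_zero.1 h0).resolve_left hr.ne') s
      rw [(mul_eq_zero.1 this).resolve_left h.ne', mul_zero])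
    (fun h0 => by
      have := mul_eq_zero_of_outputDist_eq_zero hP hK' ((mul_eq_zero.1 h0).resolve_left ht.1.ne') s
      rw [(mul_eq_zero.1 this).resolve_left h.ne', mul_zero])
  rw [mul_div_mul_left _ _ hr.ne', mul_div_mul_left _ _ ht.1.ne'] at this
  have := mul_le_mul_of_nonneg_left this h.le
  linarith

/-! ### Finite distortion and the Lagrangian -/

/-- The expected distortion as a real number, when it is finite. -/
noncomputable def realDistortion (P : S → ℝ) (d : S → Sh → ℝ≥0∞) (K : S → Sh → ℝ) : ℝ :=
  ∑ s, ∑ sh, P s * K s sh * (d s sh).toReal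

/-- The channel avoids pairs of infinite distortion. -/
def AvoidsTop (P : S → ℝ) (d : S → Sh → ℝ≥0∞) (K : S → Sh → ℝ) : Prop :=
  ∀ s sh, P s * K s sh ≠ 0 → d s sh ≠ ⊤

theorem expectedDistortion_eq {P : S → ℝ} (hP : P ∈ stdSimplex ℝ S) {d : S → Sh → ℝ≥0∞}
    {K : S → Sh → ℝ} (hK : IsKernel K) (h : AvoidsTop P d K) :
    expectedDistortion P d K = ENNReal.ofReal (realDistortion P d K) := by
  have h0 s sh : 0 ≤ P s * K s sh := mul_nonneg (hP.1 s) ((hK s).1 sh)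
  have h1 s sh : 0 ≤ P s * K s sh * (d s sh).toReal := mul_nonneg (h0 s sh) ENNReal.toReal_nonneg
  rw [realDistortion, ENNReal.ofReal_sum_of_nonneg fun s _ => Finset.sum_nonneg fun sh _ => h1 s sh]
  refine Finset.sum_congr rfl fun s _ => ?_
  rw [ENNReal.ofReal_sum_of_nonneg fun sh _ => h1 s sh]
  refine Finset.sum_congr rfl fun sh _ => ?_
  by_cases hz : P s * K s sh = 0
  · simp [hz]
  · rw [ENNReal.ofReal_mul (h0 s sh), ENNReal.ofReal_toReal (h s sh hz)]

theorem realDistortion_nonneg {P : S → ℝ} (hP : P ∈ stdSimplex ℝ S) (d : S → Sh → ℝ≥0∞)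
    {K : S → Sh → ℝ} (hK : IsKernel K) : 0 ≤ realDistortion P d K :=
  Finset.sum_nonneg fun s _ => Finset.sum_nonneg fun sh _ =>
    mul_nonneg (mul_nonneg (hP.1 s) ((hK s).1 sh)) ENNReal.toReal_nonneg

/-- A finite bound forbids mass on pairs of infinite distortion. The constraint then becomes a real
inequality linear in the channel, stable under mixing. -/
theorem isTestChannel_iff {P : S → ℝ} (hP : P ∈ stdSimplex ℝ S) {d : S → Sh → ℝ≥0∞}
    {K : S → Sh → ℝ} {D : ℝ} :
    IsTestChannel P d D K ↔ IsKernel K ∧ AvoidsTop P d K ∧ realDistortion P d K ≤ D := by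
  refine and_congr_right fun hK => ⟨fun h => ?_, fun ⟨ha, h⟩ => ?_⟩
  · have ha : AvoidsTop P d K := by
      intro s sh hz hd
      have hpos : 0 < P s * K s sh :=
        lt_of_le_of_ne (mul_nonneg (hP.1 s) ((hK s).1 sh)) (Ne.symm hz)
      have : expectedDistortion P d K = ⊤ :=
        ENNReal.sum_eq_top.2 ⟨s, Finset.mem_univ s, ENNReal.sum_eq_top.2 ⟨sh, Finset.mem_univ sh, by
          rw [hd, ENNReal.mul_top (ENNReal.ofReal_pos.2 hpos).ne']⟩⟩
      rw [this] at h
      simp at h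
    refine ⟨ha, ?_⟩
    rw [expectedDistortion_eq hP hK ha, EReal.coe_ennreal_ofReal,
      max_eq_left (realDistortion_nonneg hP d hK)] at h
    exact_mod_cast h
  · rw [expectedDistortion_eq hP hK ha, EReal.coe_ennreal_ofReal,
      max_eq_left (realDistortion_nonneg hP d hK)]
    exact_mod_cast h

theorem realDistortion_mix (P : S → ℝ) (d : S → Sh → ℝ≥0∞) (K K' : S → Sh → ℝ) (t : ℝ) :
    realDistortion P d (fun s sh => (1 - t) * K s sh + t * K' s sh) =
      (1 - t) * realDistortion P d K + t * realDistortion P d K' := by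
  simp only [realDistortion, Finset.mul_sum]
  rw [← Finset.sum_add_distrib]
  refine Finset.sum_congr rfl fun s _ => ?_
  rw [← Finset.sum_add_distrib]
  exact Finset.sum_congr rfl fun sh _ => by ring

omit [Fintype S] [Fintype Sh] in
theorem AvoidsTop.mix {P : S → ℝ} {d : S → Sh → ℝ≥0∞} {K K' : S → Sh → ℝ}
    (h : AvoidsTop P d K) (h' : AvoidsTop P d K') (t : ℝ) :
    AvoidsTop P d fun s sh => (1 - t) * K s sh + t * K' s sh := by
  intro s sh hz
  by_cases h0 : P s * K s sh = 0
  · refine h' s sh fun h1 => hz ?_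
    linear_combination (1 - t) * h0 + t * h1
  · exact h s sh h0

/-- A test channel bounds the rate-distortion function as a real number. -/
theorem toReal_rateDistortion_le {P : S → ℝ} (hP : P ∈ stdSimplex ℝ S) {d : S → Sh → ℝ≥0∞}
    {K : S → Sh → ℝ} {D : ℝ} (hK : IsTestChannel P d D K) :
    (rateDistortion P d D).toReal ≤ mutualInfo P K := by
  have h1 : rateDistortion P d D ≤ ((mutualInfo P K : ℝ) : EReal) := iInf₂_le K hK
  -- Nonnegativity excludes `⊥`, where `toReal` would return the default value zero and break
  -- monotonicity.
  have h2 : (0 : EReal) ≤ rateDistortion P d D :=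
    le_iInf₂ fun K' hK' => EReal.coe_nonneg.2 (mutualInfo_nonneg hP hK'.1)
  have := EReal.toReal_le_toReal h1 (ne_bot_of_le_ne_bot EReal.zero_ne_bot h2)
    (EReal.coe_ne_top _)
  rwa [EReal.toReal_coe] at this

/-- An optimal test channel minimizes the Lagrangian with multiplier `λ* = -R'(D)`. -/
theorem IsOptimalTestChannel.lagrangian_le {P : S → ℝ} (hP : P ∈ stdSimplex ℝ S)
    {d : S → Sh → ℝ≥0∞} {D : ℝ} {K : S → Sh → ℝ} (hK : IsOptimalTestChannel P d D K)
    (hd : DifferentiableAt ℝ (fun r : ℝ => (rateDistortion P d r).toReal) D)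
    {K' : S → Sh → ℝ} (hK' : IsKernel K') (ha' : AvoidsTop P d K') :
    mutualInfo P K + lamStar P d D * D ≤
      mutualInfo P K' + lamStar P d D * realDistortion P d K' := by
  obtain ⟨hKk, hKa, hKD⟩ := (isTestChannel_iff hP).1 hK.1
  set δ := realDistortion P d K'
  set R : ℝ → ℝ := fun r => (rateDistortion P d r).toReal with hR
  have hRD : R D = mutualInfo P K := by
    simp only [hR]
    rw [← hK.2, EReal.toReal_coe]
  -- The mixture of `K` and `K'` is a test channel at distortion `D + t(δ - D)`, so the
  -- rate-distortion function lies below the chord there; dividing by `t → 0+` yields the inequality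
  -- for its derivative.
  have hmix : ∀ t ∈ Set.Ioo (0 : ℝ) 1,
      R (D + t * (δ - D)) ≤ R D + t * (mutualInfo P K' - R D) := by
    intro t ht
    have h1 : IsTestChannel P d (D + t * (δ - D))
        (fun s sh => (1 - t) * K s sh + t * K' s sh) := by
      refine (isTestChannel_iff hP).2
        ⟨hKk.mix hK' ⟨ht.1.le, ht.2.le⟩, hKa.mix ha' t, ?_⟩
      rw [realDistortion_mix]
      linarith [mul_le_mul_of_nonneg_left hKD (sub_nonneg.2 ht.2.le)]
    have h2 := toReal_rateDistortion_le hP h1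
    have h3 := mutualInfo_mix_le hP hKk hK' ht
    rw [hRD]
    simp only [hR]
    linarith
  have hline : HasDerivAt (fun t : ℝ => R (D + t * (δ - D))) (deriv R D * (δ - D)) 0 := by
    have hl : HasDerivAt (fun t : ℝ => D + t * (δ - D)) (δ - D) 0 := by
      simpa using ((hasDerivAt_id (0 : ℝ)).mul_const (δ - D)).const_add D
    have hR' : HasDerivAt R (deriv R D) (D + 0 * (δ - D)) := by
      simpa using hd.hasDerivAt
    exact hR'.comp (0 : ℝ) hl
  have hslope := hline.tendsto_slope_zero_right
  have hle : deriv R D * (δ - D) ≤ mutualInfo P K' - R D := by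
    refine le_of_tendsto hslope ?_
    filter_upwards [Ioo_mem_nhdsGT (zero_lt_one' ℝ)] with t ht
    have h4 := hmix t ht
    simp only [zero_add, zero_mul, add_zero, smul_eq_mul]
    rw [inv_mul_le_iff₀ ht.1]
    linarith
  have : lamStar P d D = -deriv R D := rfl
  rw [this, ← hRD]
  linarith

/-! ### Tilted channels and the Kuhn-Tucker conditions -/

theorem expTilt_nonneg (l D : ℝ) (δ : ℝ≥0∞) : 0 ≤ expTilt l D δ := by
  unfold expTilt
  split_ifs
  · exact le_rfl
  · exact (Real.exp_pos _).le

theorem expTilt_of_ne_top (l D : ℝ) {δ : ℝ≥0∞} (h : δ ≠ ⊤) :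
    expTilt l D δ = Real.exp (l * D - l * δ.toReal) := by
  simp [expTilt, h]

/-- `𝔼[exp(l D - l d(s, Ŝ))]` with `Ŝ` distributed as `q`. -/
noncomputable def tiltSum (d : S → Sh → ℝ≥0∞) (l D : ℝ) (q : Sh → ℝ) (s : S) : ℝ :=
  ∑ sh, q sh * expTilt l D (d s sh)

omit [Fintype S] in
theorem tiltSum_nonneg (d : S → Sh → ℝ≥0∞) (l D : ℝ) {q : Sh → ℝ} (hq : q ∈ stdSimplex ℝ Sh)
    (s : S) : 0 ≤ tiltSum d l D q s :=
  Finset.sum_nonneg fun sh _ => mul_nonneg (hq.1 sh) (expTilt_nonneg _ _ _)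

theorem tiltSum_outputDist_pos {P : S → ℝ} (hP : P ∈ stdSimplex ℝ S) {d : S → Sh → ℝ≥0∞}
    (l D : ℝ) {K : S → Sh → ℝ} (hK : IsKernel K) (ha : AvoidsTop P d K) {s : S} (hs : P s ≠ 0) :
    0 < tiltSum d l D (outputDist P K) s := by
  have hq := outputDist_mem_stdSimplex hP hK
  obtain ⟨sh, hsh⟩ : ∃ sh, K s sh ≠ 0 := by
    by_contra! h
    have := (hK s).2
    simp [h] at this
  have hz : P s * K s sh ≠ 0 := mul_ne_zero hs hsh
  refine Finset.sum_pos' (fun sh _ => mul_nonneg (hq.1 sh) (expTilt_nonneg _ _ _))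
    ⟨sh, Finset.mem_univ sh, mul_pos (lt_of_le_of_ne (hq.1 sh) fun h => hz
      (mul_eq_zero_of_outputDist_eq_zero hP hK h.symm s)) ?_⟩
  rw [expTilt_of_ne_top l D (ha s sh hz)]
  exact Real.exp_pos _

/-- The Lagrangian of a channel is bounded below by the log-partition function of its output. -/
theorem neg_sum_log_tiltSum_le {P : S → ℝ} (hP : P ∈ stdSimplex ℝ S) {d : S → Sh → ℝ≥0∞}
    (l D : ℝ) {K : S → Sh → ℝ} (hK : IsKernel K) (ha : AvoidsTop P d K) :
    -∑ s, P s * Real.log (tiltSum d l D (outputDist P K) s) ≤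
      mutualInfo P K + l * realDistortion P d K - l * D := by
  have hq := outputDist_mem_stdSimplex hP hK
  set q := outputDist P K with hqdef
  have hs s : P s * -Real.log (tiltSum d l D q s) ≤ ∑ sh, (P s * K s sh * Real.log (K s sh / q sh)
      + l * (P s * K s sh * (d s sh).toReal)) - P s * (l * D) := by
    rcases (hP.1 s).eq_or_lt with h | h
    · simp [← h]
    have hZ : 0 < tiltSum d l D q s := tiltSum_outputDist_pos hP l D hK ha h.ne'
    have h1 : ∑ sh, P s * (K s sh * (-Real.log (tiltSum d l D q s)) + K s sh -
        q sh * expTilt l D (d s sh) / tiltSum d l D q s) ≤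
        ∑ sh, (P s * K s sh * Real.log (K s sh / q sh) +
          l * (P s * K s sh * (d s sh).toReal) - P s * K s sh * (l * D)) := by
      refine Finset.sum_le_sum fun sh _ => ?_
      by_cases hk : K s sh = 0
      · rw [hk]
        simp only [zero_mul, mul_zero, add_zero, sub_zero, zero_sub]
        have := mul_nonneg h.le (div_nonneg (mul_nonneg (hq.1 sh) (expTilt_nonneg l D (d s sh)))
          hZ.le)
        linarith
      have hz : P s * K s sh ≠ 0 := mul_ne_zero h.ne' hk
      -- The tangent is taken at the density of the tilted channel with respect to `q`. Its linear
      -- terms cancel in the sum over `sh`, both channels having total mass one.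
      have := tangent_le_mul_log_div (c := expTilt l D (d s sh) / tiltSum d l D q s)
        ((hK s).1 sh) (hq.1 sh)
        (fun h0 => (hz (mul_eq_zero_of_outputDist_eq_zero hP hK h0 s)).elim)
        (div_pos (by rw [expTilt_of_ne_top l D (ha s sh hz)]; exact Real.exp_pos _) hZ)
      rw [expTilt_of_ne_top l D (ha s sh hz)] at this ⊢
      rw [Real.log_div (Real.exp_pos _).ne' hZ.ne', Real.log_exp] at this
      have := mul_le_mul_of_nonneg_left this h.le
      rw [← mul_div_assoc] at this
      linarith
    have h2 : ∑ sh, P s * (K s sh * (-Real.log (tiltSum d l D q s)) + K s sh -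
        q sh * expTilt l D (d s sh) / tiltSum d l D q s) =
        P s * -Real.log (tiltSum d l D q s) := by
      rw [← Finset.mul_sum, Finset.sum_sub_distrib, Finset.sum_add_distrib, ← Finset.sum_mul,
        ← Finset.sum_div, (hK s).2]
      change P s * (1 * -Real.log (tiltSum d l D q s) + 1 -
        tiltSum d l D q s / tiltSum d l D q s) = _
      rw [div_self hZ.ne']
      ring
    rw [h2, Finset.sum_sub_distrib, ← Finset.sum_mul, ← Finset.mul_sum (a := P s), (hK s).2,
      mul_one] at h1
    exact h1
  have := Finset.sum_le_sum fun s (_ : s ∈ Finset.univ) => hs s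
  simp only [Finset.sum_sub_distrib, Finset.sum_add_distrib, ← Finset.sum_mul, hP.2, one_mul,
    ← Finset.mul_sum, mul_neg, Finset.sum_neg_distrib] at this
  exact this

open Classical in
/-- The channel tilted from the output distribution `q`. -/
noncomputable def tiltedChannel (d : S → Sh → ℝ≥0∞) (l D : ℝ) (q : Sh → ℝ) (s : S) (sh : Sh) : ℝ :=
  if tiltSum d l D q s = 0 then q sh else q sh * expTilt l D (d s sh) / tiltSum d l D q s

omit [Fintype S] in
theorem isKernel_tiltedChannel (d : S → Sh → ℝ≥0∞) (l D : ℝ) {q : Sh → ℝ}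
    (hq : q ∈ stdSimplex ℝ Sh) : IsKernel (tiltedChannel d l D q) := by
  intro s
  -- The fallback row `q` keeps the channel a kernel where the partition function vanishes.
  by_cases h : tiltSum d l D q s = 0
  · have : tiltedChannel d l D q s = q := by
      ext sh
      simp [tiltedChannel, h]
    rwa [this]
  · refine ⟨fun sh => ?_, ?_⟩
    · simp only [tiltedChannel, h, if_false]
      exact div_nonneg (mul_nonneg (hq.1 sh) (expTilt_nonneg _ _ _)) (tiltSum_nonneg d l D hq s)
    · simp only [tiltedChannel, h, if_false]
      rw [← Finset.sum_div]
      exact div_self h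

omit [Fintype S] in
theorem avoidsTop_tiltedChannel {P : S → ℝ} (d : S → Sh → ℝ≥0∞) (l D : ℝ) {q : Sh → ℝ}
    (hZ : ∀ s, P s ≠ 0 → 0 < tiltSum d l D q s) : AvoidsTop P d (tiltedChannel d l D q) := by
  intro s sh hz hd
  refine right_ne_zero_of_mul hz ?_
  simp [tiltedChannel, (hZ s (left_ne_zero_of_mul hz)).ne', hd, expTilt]

/-- The tilted channel has log-density `l D - l d - log Z` with respect to `q`, so with
`condDivergence` in place of mutual information this is an equality. Replacing `q` by the true
output law only lowers the left side. -/
theorem lagrangian_tiltedChannel_le {P : S → ℝ} (hP : P ∈ stdSimplex ℝ S) (d : S → Sh → ℝ≥0∞)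
    (l D : ℝ) {q : Sh → ℝ} (hq : q ∈ stdSimplex ℝ Sh)
    (hZ : ∀ s, P s ≠ 0 → 0 < tiltSum d l D q s) :
    mutualInfo P (tiltedChannel d l D q) + l * realDistortion P d (tiltedChannel d l D q) - l * D ≤
      -∑ s, P s * Real.log (tiltSum d l D q s) := by
  have hK := isKernel_tiltedChannel d l D hq
  have ha := avoidsTop_tiltedChannel (P := P) d l D hZ
  have hKeq s sh (hs : P s ≠ 0) : tiltedChannel d l D q s sh =
      q sh * expTilt l D (d s sh) / tiltSum d l D q s := by
    simp [tiltedChannel, (hZ s hs).ne']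
  have hq0 s sh (h0 : q sh = 0) : P s * tiltedChannel d l D q s sh = 0 := by
    by_cases hs : P s = 0
    · simp [hs]
    · simp [hKeq s sh hs, h0]
  have h1 := mutualInfo_le_condDivergence hP hK hq hq0
  have h2 : condDivergence P (tiltedChannel d l D q) q +
      l * realDistortion P d (tiltedChannel d l D q) - l * D =
      -∑ s, P s * Real.log (tiltSum d l D q s) := by
    have hs s : ∑ sh, (P s * tiltedChannel d l D q s sh *
          Real.log (tiltedChannel d l D q s sh / q sh)
        + l * (P s * tiltedChannel d l D q s sh * (d s sh).toReal)) =
        P s * (l * D) - P s * Real.log (tiltSum d l D q s) := by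
      have : P s * (l * D) - P s * Real.log (tiltSum d l D q s) =
          ∑ sh, P s * tiltedChannel d l D q s sh * (l * D - Real.log (tiltSum d l D q s)) := by
        rw [← Finset.sum_mul, ← Finset.mul_sum, (hK s).2]
        ring
      rw [this]
      refine Finset.sum_congr rfl fun sh _ => ?_
      by_cases hz : P s * tiltedChannel d l D q s sh = 0
      · simp [hz]
      have hPs := left_ne_zero_of_mul hz
      have hqs : q sh ≠ 0 := fun h0 => hz (hq0 s sh h0)
      have : tiltedChannel d l D q s sh / q sh =
          Real.exp (l * D - l * (d s sh).toReal) / tiltSum d l D q s := by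
        rw [hKeq s sh hPs, expTilt_of_ne_top l D (ha s sh hz)]
        field_simp
      rw [this, Real.log_div (Real.exp_pos _).ne' (hZ s hPs).ne', Real.log_exp]
      ring
    have := Finset.sum_congr rfl fun s (_ : s ∈ Finset.univ) => hs s
    simp only [Finset.sum_sub_distrib, Finset.sum_add_distrib, ← Finset.sum_mul, hP.2, one_mul,
      ← Finset.mul_sum] at this
    simp only [condDivergence, realDistortion]
    linarith
  linarith

/-- If `1` maximizes `r ↦ 𝔼[log r]` on the segment towards `r`, then `𝔼[r] ≤ 1`. -/
theorem sum_mul_le_one_of_sum_mul_log_le {P : S → ℝ} (hP : P ∈ stdSimplex ℝ S) {r : S → ℝ}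
    (hr : ∀ s, 0 ≤ r s)
    (h : ∀ t ∈ Set.Ioo (0 : ℝ) 1, ∑ s, P s * Real.log ((1 - t) + t * r s) ≤ 0) :
    ∑ s, P s * r s ≤ 1 := by
  -- From `log x ≥ 1 - 1/x` at `x = 1 - t + t r`, after division by `t`; the limit `t → 0+` then
  -- gives `𝔼[r - 1] ≤ 0`.
  have h1 : ∀ t ∈ Set.Ioo (0 : ℝ) 1, ∑ s, P s * ((r s - 1) / ((1 - t) + t * r s)) ≤ 0 := by
    intro t ht
    have h2 : ∑ s, P s * (t * ((r s - 1) / ((1 - t) + t * r s))) ≤ 0 := by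
      refine le_trans (Finset.sum_le_sum fun s _ => mul_le_mul_of_nonneg_left ?_ (hP.1 s)) (h t ht)
      have hx : 0 < (1 - t) + t * r s :=
        add_pos_of_pos_of_nonneg (sub_pos.2 ht.2) (mul_nonneg ht.1.le (hr s))
      have := Real.one_sub_inv_le_log_of_pos hx
      refine le_trans (le_of_eq ?_) this
      field_simp
      ring
    have h3 : ∑ s, P s * (t * ((r s - 1) / ((1 - t) + t * r s))) =
        t * ∑ s, P s * ((r s - 1) / ((1 - t) + t * r s)) := by
      rw [Finset.mul_sum]
      exact Finset.sum_congr rfl fun s _ => by ring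
    rw [h3] at h2
    exact nonpos_of_mul_nonpos_right h2 ht.1
  have hc : Filter.Tendsto (fun t : ℝ => ∑ s, P s * ((r s - 1) / ((1 - t) + t * r s)))
      (nhdsWithin 0 (Set.Ioi 0)) (nhds (∑ s, P s * (r s - 1))) := by
    have : ContinuousAt (fun t : ℝ => ∑ s, P s * ((r s - 1) / ((1 - t) + t * r s))) 0 := by
      refine tendsto_finsetSum _ fun s _ => ?_
      refine ContinuousAt.mul continuousAt_const (ContinuousAt.div continuousAt_const ?_ (by simp))
      fun_prop
    have := this.tendsto.mono_left (nhdsWithin_le_nhds (s := Set.Ioi 0))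
    simpa using this
  have := le_of_tendsto hc (by
    filter_upwards [Ioo_mem_nhdsGT (zero_lt_one' ℝ)] with t ht using h1 t ht)
  simp only [mul_sub, mul_one, Finset.sum_sub_distrib, hP.2] at this
  linarith

/-- The optimality conditions of the rate-distortion problem, at every reproduction symbol. -/
theorem IsOptimalTestChannel.sum_mul_expTilt_div_le_one {P : S → ℝ} (hP : P ∈ stdSimplex ℝ S)
    {d : S → Sh → ℝ≥0∞} {D : ℝ} {K : S → Sh → ℝ} (hK : IsOptimalTestChannel P d D K)
    (hd : DifferentiableAt ℝ (fun r : ℝ => (rateDistortion P d r).toReal) D)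
    (hl : 0 ≤ lamStar P d D) (sh : Sh) :
    ∑ s, P s * (expTilt (lamStar P d D) D (d s sh) /
      tiltSum d (lamStar P d D) D (outputDist P K) s) ≤ 1 := by
  classical
  obtain ⟨hKk, hKa, hKD⟩ := (isTestChannel_iff hP).1 hK.1
  set l := lamStar P d D with hldef
  set q := outputDist P K with hqdef
  have hq : q ∈ stdSimplex ℝ Sh := outputDist_mem_stdSimplex hP hKk
  have hZ s (hs : P s ≠ 0) : 0 < tiltSum d l D q s := tiltSum_outputDist_pos hP l D hKk hKa hs
  refine sum_mul_le_one_of_sum_mul_log_le hP (fun s => div_nonneg (expTilt_nonneg _ _ _)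
    (tiltSum_nonneg d l D hq s)) fun t ht => ?_
  -- Perturbing towards a point mass also reaches symbols outside the support of `q`; the partition
  -- function is affine along the segment.
  set q' : Sh → ℝ := fun sh' => (1 - t) * q sh' + t * (Pi.single sh 1 : Sh → ℝ) sh' with hq'def
  have hq' : q' ∈ stdSimplex ℝ Sh :=
    convex_stdSimplex ℝ Sh hq (single_mem_stdSimplex ℝ sh) (sub_nonneg.2 ht.2.le) ht.1.le (by ring)
  have hZeq s : tiltSum d l D q' s = (1 - t) * tiltSum d l D q s + t * expTilt l D (d s sh) := by
    simp only [tiltSum, hq'def, add_mul, Finset.sum_add_distrib, mul_assoc, ← Finset.mul_sum]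
    congr 2
    simp [Pi.single_apply]
  have hZ' s (hs : P s ≠ 0) : 0 < tiltSum d l D q' s := by
    rw [hZeq]
    exact add_pos_of_pos_of_nonneg (mul_pos (sub_pos.2 ht.2) (hZ s hs))
      (mul_nonneg ht.1.le (expTilt_nonneg _ _ _))
  -- With `h2`, `h3` and `h4` this gives `-𝔼[log Z_q] ≤ I(K) ≤ -𝔼[log Z_q']`.
  have h1 := lagrangian_tiltedChannel_le hP d l D hq' hZ'
  have h2 := hK.lagrangian_le hP hd (isKernel_tiltedChannel d l D hq')
    (avoidsTop_tiltedChannel d l D hZ')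
  have h3 := neg_sum_log_tiltSum_le hP l D hKk hKa
  have h4 := mul_le_mul_of_nonneg_left hKD hl
  have h5 : ∑ s, P s * Real.log ((1 - t) + t * (expTilt l D (d s sh) / tiltSum d l D q s)) =
      ∑ s, P s * Real.log (tiltSum d l D q' s) - ∑ s, P s * Real.log (tiltSum d l D q s) := by
    rw [← Finset.sum_sub_distrib]
    refine Finset.sum_congr rfl fun s _ => ?_
    by_cases hs : P s = 0
    · simp [hs]
    rw [← mul_sub, ← Real.log_div (hZ' s hs).ne' (hZ s hs).ne', hZeq, add_div,
      mul_div_cancel_right₀ _ (hZ s hs).ne', mul_div_assoc]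
  rw [h5]
  linarith

end RateDistortion

/-! ### Bounding the cover term by `exp(-γ)` -/

section Cover

variable {S X Y Sh : Type*} [Fintype S] [Fintype Y] [Fintype Sh]

/-- A Chernoff bound: the exponent `l(D - δ)` is nonnegative on the event. -/
theorem ind_le_expTilt {l : ℝ} (hl : 0 ≤ l) (D : ℝ≥0) (δ : ℝ≥0∞) :
    ind (δ ≤ (D : ℝ≥0∞)) ≤ expTilt l D δ := by
  by_cases h : δ ≤ (D : ℝ≥0∞)
  · have ht : δ ≠ ⊤ := ne_top_of_le_ne_top ENNReal.coe_ne_top h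
    have hr : δ.toReal ≤ D := ENNReal.toReal_le_coe_of_le_coe h
    rw [expTilt_of_ne_top l D ht, ind, if_pos h]
    exact Real.one_le_exp (sub_nonneg.2 (mul_le_mul_of_nonneg_left hr hl))
  · rw [ind, if_neg h]
    exact expTilt_nonneg _ _ _

theorem coverTerm_eq (P : S → ℝ) (d : S → Sh → ℝ≥0∞) (D : ℝ≥0) (γ : ℝ) (sh : Sh) :
    coverTerm P d D γ sh = Real.exp (-γ) *
      ∑ s, P s * (Real.exp (tiltedInfo P d D s) * ind (d s sh ≤ (D : ℝ≥0∞))) := by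
  rw [coverTerm, Finset.mul_sum]
  refine Finset.sum_congr rfl fun s _ => ?_
  rw [sub_eq_add_neg, Real.exp_add]
  ring

/-- Where `P s > 0`, `exp(j)` is the reciprocal of the partition function; after the Chernoff bound
the sum is the one in the Kuhn-Tucker condition. -/
theorem coverTerm_le_of_tiltedRegular {P : S → ℝ} (hP : P ∈ stdSimplex ℝ S)
    {d : S → Sh → ℝ≥0∞} {D : ℝ≥0} (hD0 : D ≠ 0) (hD : TiltedRegular P d D) (γ : ℝ) (sh : Sh) :
    coverTerm P d D γ sh ≤ Real.exp (-γ) := by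
  rw [coverTerm_eq]
  refine mul_le_of_le_one_right (Real.exp_pos _).le ?_
  have hK : IsOptimalTestChannel P d D (optimalTestChannel P d D) := by
    rw [optimalTestChannel, dif_pos hD.exists_optimal]
    exact hD.exists_optimal.choose_spec
  obtain ⟨hKk, hKa, -⟩ := (isTestChannel_iff hP).1 hK.1
  refine le_trans (Finset.sum_le_sum fun s _ => ?_)
    (hK.sum_mul_expTilt_div_le_one hP hD.differentiable hD.lamStar_pos.le sh)
  by_cases hs : P s = 0
  · simp [hs]
  refine mul_le_mul_of_nonneg_left ?_ (hP.1 s)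
  have hZ := tiltSum_outputDist_pos hP (lamStar P d D) D hKk hKa hs
  have : Real.exp (tiltedInfo P d D s) =
      1 / tiltSum d (lamStar P d D) D (outputDist P (optimalTestChannel P d D)) s := by
    rw [tiltedInfo, if_neg hD0]
    exact Real.exp_log (one_div_pos.2 hZ)
  rw [this, one_div, mul_comm, div_eq_mul_inv]
  exact mul_le_mul_of_nonneg_right (ind_le_expTilt hD.lamStar_pos.le D _) (inv_nonneg.2 hZ.le)

/-- Here `exp(j) = 1 / P s`, so each source symbol of positive probability at distortion zero
contributes exactly one, and there is at most one such symbol. -/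
theorem coverTerm_zero_le {P : S → ℝ} (hP : P ∈ stdSimplex ℝ S) {d : S → Sh → ℝ≥0∞} {sh : Sh}
    (h : ∀ s s', 0 < P s → 0 < P s' → d s sh = 0 → d s' sh = 0 → s = s') (γ : ℝ) :
    coverTerm P d 0 γ sh ≤ Real.exp (-γ) := by
  rw [coverTerm_eq]
  refine mul_le_of_le_one_right (Real.exp_pos _).le ?_
  have hz s (hs : ¬(0 < P s ∧ d s sh = 0)) :
      P s * (Real.exp (tiltedInfo P d 0 s) * ind (d s sh ≤ ((0 : ℝ≥0) : ℝ≥0∞))) = 0 := by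
    rcases (hP.1 s).eq_or_lt with h0 | h0
    · simp [← h0]
    · have : ¬d s sh ≤ ((0 : ℝ≥0) : ℝ≥0∞) := by simpa using fun h1 => hs ⟨h0, h1⟩
      rw [ind, if_neg this, mul_zero, mul_zero]
  by_cases hex : ∃ s, 0 < P s ∧ d s sh = 0
  · obtain ⟨s, hs, hds⟩ := hex
    rw [Finset.sum_eq_single s
      (fun s' _ hne => hz s' fun hs' => hne (h s' s hs'.1 hs hs'.2 hds)) (by simp)]
    rw [tiltedInfo, if_pos rfl, Real.exp_log (one_div_pos.2 hs), ind, if_pos (by simp [hds]),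
      mul_one, mul_one_div_cancel hs.ne']
  · push Not at hex
    rw [Finset.sum_eq_zero fun s _ => hz s fun hs => hex s hs.1 hs.2]
    exact zero_le_one

theorem oldValue_le_newValue_of_coverTerm_le [Nonempty Sh] {P : S → ℝ} {d : S → Sh → ℝ≥0∞}
    {D : ℝ≥0} {γ : ℝ} (h : ∀ sh, coverTerm P d D γ sh ≤ Real.exp (-γ)) {W : X → Y → ℝ} {T : ℕ}
    (A : Auxiliary W T) : oldValue P d D γ A ≤ newValue P d D γ A :=
  sub_le_sub_left (mul_le_mul_of_nonneg_left (ciSup_le h) T.cast_nonneg) _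

end Cover

end JSCC

theorem mainTheorem5 {S X Y Sh : Type*} [Fintype S] [Fintype X] [Fintype Y] [Fintype Sh]
    [Nonempty X] [Nonempty Sh]
    (P : S → ℝ) (hP : P ∈ stdSimplex ℝ S)
    (W : X → Y → ℝ) (hW : IsKernel W)
    (d : S → Sh → ℝ≥0∞) (D : ℝ≥0)
    (hD : D = 0 ∨ TiltedRegular P d D) :
    -- every deterministic and every randomized code
    (∀ (f : S → X) (g : Y → Sh),
      optSC P W (excessLoss X Y d D) ≤
        ((codeLoss P W (excessLoss X Y d D) f g : ℝ) : EReal)) ∧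
    (∀ (Q : S → X → ℝ) (R : Y → Sh → ℝ), IsKernel Q → IsKernel R →
      optSC P W (excessLoss X Y d D) ≤
        ((expectedLoss P W (excessLoss X Y d D) Q R : ℝ) : EReal)) ∧
    -- the chain of lower bounds
    optDP P W (excessLoss X Y d D) ≤ optSC P W (excessLoss X Y d D) ∧
    newBound P W d D ≤ optDP P W (excessLoss X Y d D) ∧
    -- the improved value is attained at a dual feasible point with `γb` optimal
    (∀ (γ : ℝ) (T : ℕ), 0 < T → ∀ A : Auxiliary W T,
      (dualPoint P d D γ A).Feasible P W (excessLoss X Y d D) ∧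
      (dualPoint P d D γ A).objective = newValue P d D γ A ∧
      ∀ γb : Y → ℝ,
        DualPoint.Feasible P W (excessLoss X Y d D) { dualPoint P d D γ A with γb := γb } →
        ∀ y, γb y ≤ (dualPoint P d D γ A).γb y) ∧
    -- the improvement over the earlier converse
    ((D = 0 → ∀ (sh : Sh) (s s' : S), 0 < P s → 0 < P s' →
        d s sh = 0 → d s' sh = 0 → s = s') →
      (∀ (γ : ℝ) (T : ℕ), 0 < T → ∀ A : Auxiliary W T,
        oldValue P d D γ A ≤ newValue P d D γ A) ∧
      oldBound P W d D ≤ newBound P W d D) := by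
  refine ⟨optSC_le_codeLoss P W _, fun Q R hQ hR => optSC_le_expectedLoss P W _ hQ hR,
    optDP_le_optSC P W _, newBound_le_optDP hP W d D, fun γ T _ A =>
      ⟨dualPoint_feasible hP d D γ A, dualPoint_objective hP d D γ A,
        fun γb h y => le_dualPoint_γb h y⟩, fun h0 => ?_⟩
  have hcover (γ : ℝ) (sh : Sh) : coverTerm P d D γ sh ≤ Real.exp (-γ) := by
    rcases eq_or_ne D 0 with rfl | hD0
    · exact coverTerm_zero_le hP (h0 rfl sh) γ
    · exact coverTerm_le_of_tiltedRegular hP hD0 (hD.resolve_left hD0) γ sh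
  exact ⟨fun γ T _ A => oldValue_le_newValue_of_coverTerm_le (hcover γ) A,
    iSup₂_mono fun γ T => iSup₂_mono fun _ A =>
      EReal.coe_le_coe_iff.2 (oldValue_le_newValue_of_coverTerm_le (hcover γ) A)⟩
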